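/- Let $k$ and $m$ be positive integers with $k$ even. Put $S_k(m)=1^k+2^k+\cdots+(m-1)^k$ (so $S_k(1)=0$), and let $B_k$ be the $k$-th Bernoulli number, defined by $\frac{z}{e^z-1}=\sum_{n\ge 0}B_n\frac{z^n}{n!}$ for $|z|<2\pi$. Write $B_k=N_k/D_k$ in lowest terms with $N_k,D_k\in\mathbb{Z}$ and $D_k>0$. Then $$\frac{\gcd(S_k(m),m^3)}{m}=\frac{\gcd(N_k,m^2)}{\gcd(D_k,m)},$$ where greatest common divisors are taken to be nonnegative. -/

import Mathlib

/-- The power sum `S_k(m) = 1^k + 2^k + ⋯ + (m-1)^k`. -/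
def powerSum (k m : ℕ) : ℕ := ∑ j ∈ Finset.Ico 1 m, j ^ k

/-- The (signed) numerator `N_k` of the `k`-th Bernoulli number in lowest terms. -/
def bernoulliNum (k : ℕ) : ℤ := (bernoulli k).num

/-- The positive denominator `D_k` of the `k`-th Bernoulli number in lowest terms. -/
def bernoulliDen (k : ℕ) : ℕ := (bernoulli k).den

/-! The identity is checked prime by prime. Only `p ∣ m` matters; put `e = v_p(m)`. Faulhaber's
formula writes `S_k(m)/m - B_k` as a sum of terms with `i < k`, and von Staudt–Clausen bounds their
p-adic size.

If `(p-1) ∣ k`, then `v_p(B_k) = -1` and the difference is p-integral, so the valuations agree.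
Otherwise `p ≥ 5` and `B_k` is p-integral. In general the difference is then divisible by `p^(2e)`,
so the valuations agree or both are at least `2e`, which the gcds cannot distinguish. The
obstruction is the term `i = k - 2`, when `(p-1) ∣ k - 2` and `p ∤ k`; there `B_k` is a p-adic unit
and a difference divisible by `p` suffices. -/

/-- Doubling `1, …, p-1` yields the evens below `p` and `p` plus the odds below `p`. Hence `(2^k -
1)S ≡ kp ∑ odd^(k-1)` mod `p^2`. Fermat lowers the exponent to 1, and the first `h` odds sum to
`h^2`, prime to `p`. -/
theorem prime_sq_not_dvd_sum_pow {p h k : ℕ} (hp : p.Prime) (hph : p = 2 * h + 1) (hh : 0 < h)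
    (hk : 2 ≤ k) (hpk : ¬ p ∣ k) (hmod : (p - 1) ∣ k - 2) :
    ¬ p ^ 2 ∣ ∑ j ∈ Finset.range p, j ^ k := by
  intro hdvd
  have hodd : ∑ j ∈ Finset.range p, j ^ k =
      ∑ i ∈ Finset.range h, (2 * i + 1) ^ k + ∑ i ∈ Finset.range h, (2 * i + 2) ^ k := by
    rw [hph]
    clear * - hk
    induction h with
    | zero => simp; omega
    | succ n ih =>
      rw [show 2 * (n + 1) + 1 = 2 * n + 1 + 1 + 1 by ring, Finset.sum_range_succ,
        Finset.sum_range_succ, ih, Finset.sum_range_succ, Finset.sum_range_succ]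
      ring
  have hhalf : ∑ j ∈ Finset.range p, j ^ k =
      ∑ i ∈ Finset.range h, (i + 1) ^ k + ∑ i ∈ Finset.range h, (h + i + 1) ^ k := by
    rw [hph, Finset.sum_range_succ', two_mul, Finset.sum_range_add]
    simp [show k ≠ 0 by omega]
  have hdouble : 2 ^ k * ∑ j ∈ Finset.range p, j ^ k =
      ∑ i ∈ Finset.range h, (2 * i + 2) ^ k + ∑ i ∈ Finset.range h, (p + (2 * i + 1)) ^ k := by
    rw [hhalf, mul_add, Finset.mul_sum, Finset.mul_sum]
    congr 1 <;> refine Finset.sum_congr rfl fun i _ => ?_ <;> rw [← mul_pow] <;> congr 1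
    rw [hph]; ring
  have hbinom : ∀ x : ℕ, (p : ℤ) ^ 2 ∣
      ((p : ℤ) + x) ^ k - ((x : ℤ) ^ k + k * p * (x : ℤ) ^ (k - 1)) := by
    intro x
    obtain ⟨c, hc⟩ := Polynomial.binomExpansion (Polynomial.X ^ k : Polynomial ℤ) (x : ℤ) p
    simp only [Polynomial.eval_pow, Polynomial.eval_X, Polynomial.derivative_X_pow,
      Polynomial.eval_mul, map_natCast, Polynomial.eval_natCast] at hc
    refine ⟨c, ?_⟩
    rw [add_comm (p : ℤ), hc]; ring
  have hcong : (p : ℤ) ^ 2 ∣ (2 ^ k - 1) * ((∑ j ∈ Finset.range p, j ^ k : ℕ) : ℤ)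
      - k * p * ∑ i ∈ Finset.range h, (2 * (i : ℤ) + 1) ^ (k - 1) := by
    have h1 := Finset.dvd_sum (s := Finset.range h) fun i _ => hbinom (2 * i + 1)
    have h2 := congrArg (Nat.cast : ℕ → ℤ) hdouble
    rw [Nat.cast_mul, Nat.cast_pow, Nat.cast_ofNat] at h2
    have h3 : ((∑ j ∈ Finset.range p, j ^ k : ℕ) : ℤ) = _ :=
      congrArg (Nat.cast : ℕ → ℤ) hodd
    refine h1.trans (dvd_of_eq ?_)
    rw [sub_mul, h2, one_mul, h3]
    push_cast
    rw [Finset.sum_sub_distrib, Finset.sum_add_distrib, Finset.mul_sum]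
    ring
  have hp0 : (p : ℤ) ≠ 0 := by exact_mod_cast hp.ne_zero
  have hdvd' : (p : ℤ) ^ 2 ∣ ((∑ j ∈ Finset.range p, j ^ k : ℕ) : ℤ) := by exact_mod_cast hdvd
  have hpdvd : (p : ℤ) ∣ k * ∑ i ∈ Finset.range h, (2 * (i : ℤ) + 1) ^ (k - 1) := by
    have := (dvd_sub_right (hdvd'.mul_left _)).1 hcong
    rw [sq, mul_comm (k : ℤ), mul_assoc] at this
    exact Int.dvd_of_mul_dvd_mul_left hp0 this
  have : Fact p.Prime := ⟨hp⟩
  rw [← ZMod.intCast_zmod_eq_zero_iff_dvd] at hpdvd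
  push_cast at hpdvd
  obtain ⟨t, ht⟩ := hmod
  have hfermat : ∀ i ∈ Finset.range h, (2 * (i : ZMod p) + 1) ^ (k - 1) = 2 * i + 1 := by
    intro i hi
    have hne : (2 * (i : ZMod p) + 1) ≠ 0 := by
      have : ((2 * i + 1 : ℕ) : ZMod p) ≠ 0 := by
        rw [Ne, ZMod.natCast_eq_zero_iff]
        exact Nat.not_dvd_of_pos_of_lt (by omega) (by have := Finset.mem_range.1 hi; omega)
      simpa using this
    rw [show k - 1 = (p - 1) * t + 1 by omega, pow_succ, pow_mul, ZMod.pow_card_sub_one_eq_one hne,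
      one_pow, one_mul]
  rw [Finset.sum_congr rfl hfermat] at hpdvd
  have hsum : ∀ n : ℕ, ∑ i ∈ Finset.range n, (2 * (i : ZMod p) + 1) = (n : ZMod p) ^ 2 := by
    intro n
    induction n with
    | zero => simp
    | succ n ih => rw [Finset.sum_range_succ, ih]; push_cast; ring
  rw [hsum, mul_eq_zero, pow_eq_zero_iff two_ne_zero, ZMod.natCast_eq_zero_iff,
    ZMod.natCast_eq_zero_iff] at hpdvd
  rcases hpdvd with h' | h'
  · exact hpk h'
  · exact Nat.not_dvd_of_pos_of_lt hh (by omega) h'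

/-! ### Von Staudt–Clausen: p-adic size of Bernoulli numbers -/

theorem padicNorm_sum_inv_other_primes_le_one {p : ℕ} [hp : Fact p.Prime] (s : Finset ℕ)
    (hs : ∀ q ∈ s, q.Prime ∧ q ≠ p) : padicNorm p (∑ q ∈ s, (1 : ℚ) / q) ≤ 1 := by
  refine padicNorm.sum_le' (fun q hq => ?_) zero_le_one
  obtain ⟨hq1, hq2⟩ := hs q hq
  have : padicNorm p (q : ℚ) = 1 := padicNorm.nat_eq_one_iff q |>.2 fun h =>
    hq2 ((Nat.prime_dvd_prime_iff_eq hp.out hq1).1 h).symm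
  rw [padicNorm.div, this, padicNorm.one, div_one]

theorem padicNorm_bernoulli_le_one {p k : ℕ} [hp : Fact p.Prime] (hk : Even k)
    (h : ¬ (p - 1) ∣ k) : padicNorm p (bernoulli k) ≤ 1 := by
  obtain ⟨l, rfl⟩ := even_iff_two_dvd.1 hk
  obtain ⟨z, hz⟩ := Bernoulli.vonStaudt_clausen l
  rw [eq_comm, ← eq_sub_iff_add_eq] at hz
  rw [hz]
  refine (padicNorm.sub).trans (max_le (padicNorm.of_int z) ?_)
  refine padicNorm_sum_inv_other_primes_le_one _ fun q hq => ?_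
  obtain ⟨-, hq1, hq2⟩ := Finset.mem_filter.1 hq
  exact ⟨hq1, by rintro rfl; exact h hq2⟩

theorem padicNorm_bernoulli_eq {p k : ℕ} [hp : Fact p.Prime] (hk : Even k) (hk0 : 0 < k)
    (h : (p - 1) ∣ k) : padicNorm p (bernoulli k) = p := by
  obtain ⟨l, rfl⟩ := even_iff_two_dvd.1 hk
  obtain ⟨z, hz⟩ := Bernoulli.vonStaudt_clausen l
  have hmem : p ∈ {p ∈ Finset.range (2 * l + 2) | p.Prime ∧ (p - 1) ∣ 2 * l} := by
    have := Nat.le_of_dvd hk0 h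
    exact Finset.mem_filter.2 ⟨Finset.mem_range.2 (by omega), hp.out, h⟩
  rw [← Finset.add_sum_erase _ _ hmem, eq_comm, ← eq_sub_iff_add_eq] at hz
  have hr : padicNorm p ((z : ℚ) - ∑ q ∈ Finset.erase
      {p ∈ Finset.range (2 * l + 2) | p.Prime ∧ (p - 1) ∣ 2 * l} p, (1 : ℚ) / q) ≤ 1 := by
    refine (padicNorm.sub).trans (max_le (padicNorm.of_int z) ?_)
    refine padicNorm_sum_inv_other_primes_le_one _ fun q hq => ?_
    obtain ⟨hq1, hq2⟩ := Finset.mem_erase.1 hq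
    exact ⟨(Finset.mem_filter.1 hq2).2.1, hq1⟩
  have hinv : padicNorm p (-((1 : ℚ) / p)) = p := by
    rw [padicNorm.neg, padicNorm.div, padicNorm.one, padicNorm.padicNorm_p_of_prime]
    simp
  have h1 : (1 : ℚ) < p := mod_cast hp.out.one_lt
  have hB : bernoulli (2 * l) = ((z : ℚ) - ∑ q ∈ Finset.erase
      {p ∈ Finset.range (2 * l + 2) | p.Prime ∧ (p - 1) ∣ 2 * l} p, (1 : ℚ) / q)
      + -((1 : ℚ) / p) := by rw [hz]; ring
  rw [hB, padicNorm.add_eq_max_of_ne (by rw [hinv]; exact (hr.trans_lt h1).ne), hinv]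
  exact max_eq_right (hr.trans h1.le)

theorem padicNorm_bernoulli_le (p i : ℕ) [hp : Fact p.Prime] :
    padicNorm p (bernoulli i) ≤ p := by
  have h1 : (1 : ℚ) ≤ p := mod_cast hp.out.one_le
  rcases Nat.eq_zero_or_pos i with rfl | hi
  · simpa using h1
  rcases Nat.even_or_odd i with he | ho
  · by_cases h : (p - 1) ∣ i
    · exact (padicNorm_bernoulli_eq he hi h).le
    · exact (padicNorm_bernoulli_le_one he h).trans h1
  · rcases eq_or_ne i 1 with rfl | hne
    · rw [bernoulli_one, padicNorm.div, padicNorm.neg, padicNorm.one, one_div]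
      by_cases h2 : p = 2
      · subst h2
        have := padicNorm.padicNorm_p_of_prime (p := 2)
        push_cast at this
        rw [this]; norm_num
      · have : padicNorm p ((2 : ℕ) : ℚ) = 1 := padicNorm.nat_eq_one_iff 2 |>.2 fun h =>
          h2 ((Nat.prime_dvd_prime_iff_eq hp.out Nat.prime_two).1 h)
        push_cast at this
        rw [this]; simpa using h1
    · rw [bernoulli_eq_zero_of_odd ho (by omega)]; simp

/-! ### p-adic estimates of the Faulhaber terms -/

theorem padicNorm_natCast_eq_zpow {p n : ℕ} [Fact p.Prime] (hn : n ≠ 0) :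
    padicNorm p (n : ℚ) = (p : ℚ) ^ (-(padicValNat p n : ℤ)) := by
  rw [padicNorm.eq_zpow_of_nonzero (mod_cast hn), padicValRat.of_nat]

theorem padicValNat_lt_of_one_lt {p d : ℕ} [hp : Fact p.Prime] (hd : 2 ≤ d) :
    padicValNat p (d + 1) + 1 ≤ d := by
  have h1 := Nat.le_of_dvd (by omega) (pow_padicValNat_dvd (p := p) (n := d + 1))
  have h2 := Nat.pow_le_pow_left hp.out.two_le (padicValNat p (d + 1))
  generalize padicValNat p (d + 1) = v at *
  rcases v with _ | _ | v
  · omega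
  · omega
  · have := Nat.lt_two_pow_self (n := v)
    rw [pow_add] at h2
    omega

theorem padicValNat_add_two_le_of_five_le {p d : ℕ} (hp5 : 5 ≤ p) (hd : 2 ≤ d) :
    padicValNat p (d + 1) + 2 ≤ d ∧ (3 ≤ d → padicValNat p (d + 1) + 3 ≤ d) := by
  have h1 := Nat.le_of_dvd (by omega) (pow_padicValNat_dvd (p := p) (n := d + 1))
  have h2 := Nat.pow_le_pow_left hp5 (padicValNat p (d + 1))
  generalize padicValNat p (d + 1) = v at *
  rcases v with _ | v
  · omega
  · have h3 : v < 5 ^ v := Nat.lt_pow_self (by norm_num)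
    rw [pow_succ] at h2
    omega

/-- The general term of Faulhaber's formula for `S_k(m) / m - B_k`. -/
def faulhaberTerm (k m i : ℕ) : ℚ :=
  bernoulli i * k.choose i * (m : ℚ) ^ (k - i) / ((k - i + 1 : ℕ) : ℚ)

theorem sum_range_pow_div_eq {k m : ℕ} (hm : m ≠ 0) :
    (∑ j ∈ Finset.range m, (j : ℚ) ^ k) / m - bernoulli k =
      ∑ i ∈ Finset.range k, faulhaberTerm k m i := by
  have hm' : (m : ℚ) ≠ 0 := mod_cast hm
  have hk1 : (k + 1 : ℚ) ≠ 0 := by positivity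
  rw [sum_range_pow, Finset.sum_range_succ, add_div, Finset.sum_div]
  have hlast : bernoulli k * ((k + 1).choose k : ℚ) * (m : ℚ) ^ (k + 1 - k) / (k + 1) / m
      = bernoulli k := by
    rw [Nat.choose_succ_self_right, show k + 1 - k = 1 by omega]
    push_cast
    field_simp
  rw [hlast, add_sub_cancel_right]
  refine Finset.sum_congr rfl fun i hi => ?_
  have hik := Finset.mem_range.1 hi
  have hc : ((k + 1).choose i : ℚ) * ((k - i + 1 : ℕ) : ℚ) = k.choose i * (k + 1) := by
    have := Nat.choose_mul_succ_eq k i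
    rw [show k + 1 - i = k - i + 1 by omega] at this
    exact_mod_cast this.symm
  have hki : ((k - i + 1 : ℕ) : ℚ) ≠ 0 := by positivity
  rw [faulhaberTerm, show k + 1 - i = (k - i) + 1 by omega, pow_succ, div_div,
    div_eq_div_iff (by positivity) hki]
  linear_combination bernoulli i * (m : ℚ) ^ (k - i) * m * hc

/-- Bookkeeping: `b` bounds the pole of `B_i`, `c` is the power of `p` known in the binomial, `n`
the power gained overall. -/
theorem padicNorm_faulhaberTerm_le {p k m i : ℕ} [hp : Fact p.Prime] (hm : m ≠ 0) {n b c : ℤ}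
    (hB : padicNorm p (bernoulli i) ≤ (p : ℚ) ^ b)
    (hC : padicNorm p (k.choose i : ℚ) ≤ (p : ℚ) ^ (-c))
    (h : b + padicValNat p (k - i + 1) + n ≤ c + padicValNat p m * (k - i : ℕ)) :
    padicNorm p (faulhaberTerm k m i) ≤ (p : ℚ) ^ (-n) := by
  have hp1 : (1 : ℚ) ≤ p := mod_cast hp.out.one_le
  have hp0 : (p : ℚ) ≠ 0 := mod_cast hp.out.ne_zero
  have hpow : padicNorm p ((m : ℚ) ^ (k - i)) = (p : ℚ) ^ (-(padicValNat p m * (k - i : ℕ) : ℤ)) := by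
    rw [padicNorm.eq_zpow_of_nonzero (pow_ne_zero _ (mod_cast hm)), padicValRat.pow,
      padicValRat.of_nat, mul_comm]
  rw [faulhaberTerm, padicNorm.div, padicNorm.mul, padicNorm.mul, hpow,
    padicNorm_natCast_eq_zpow (Nat.succ_ne_zero _)]
  calc _ ≤ (p : ℚ) ^ b * (p : ℚ) ^ (-c) * (p : ℚ) ^ (-(padicValNat p m * (k - i : ℕ) : ℤ)) /
        (p : ℚ) ^ (-(padicValNat p (k - i + 1) : ℤ)) := by
        have := padicNorm.nonneg (p := p) (k.choose i : ℚ)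
        gcongr
    _ = (p : ℚ) ^ (b + -c + -(padicValNat p m * (k - i : ℕ) : ℤ) -
        -(padicValNat p (k - i + 1) : ℤ)) := by
        rw [zpow_sub₀ hp0, zpow_add₀ hp0, zpow_add₀ hp0]
    _ ≤ _ := zpow_le_zpow_right₀ hp1 (by linarith)

theorem faulhaberTerm_two_one (m : ℕ) : faulhaberTerm 2 m 1 = -((m : ℚ) / (2 : ℕ)) := by
  simp [faulhaberTerm, bernoulli_one]
  ring

theorem faulhaberTerm_eq_zero_of_odd {k m i : ℕ} (hi : Odd i) (hi1 : i ≠ 1) :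
    faulhaberTerm k m i = 0 := by
  have := hi.pos
  rw [faulhaberTerm, bernoulli_eq_zero_of_odd hi (by omega)]
  simp

theorem padicNorm_faulhaberTerm_two_one_le_one {p m : ℕ} [hp : Fact p.Prime] (hpm : p ∣ m) :
    padicNorm p (faulhaberTerm 2 m 1) ≤ 1 := by
  rw [faulhaberTerm_two_one, padicNorm.neg]
  by_cases h2 : p = 2
  · subst h2
    rw [← Nat.cast_div hpm (by norm_num)]
    exact padicNorm.of_nat _
  · have : padicNorm p ((2 : ℕ) : ℚ) = 1 := padicNorm.nat_eq_one_iff 2 |>.2 fun h =>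
      h2 ((Nat.prime_dvd_prime_iff_eq hp.out Nat.prime_two).1 h)
    rw [padicNorm.div, this, div_one]
    exact padicNorm.of_nat _

theorem padicNorm_faulhaberTerm_two_one_le {p m : ℕ} [hp : Fact p.Prime] (h2 : p ≠ 2)
    (hpm : p ∣ m) : padicNorm p (faulhaberTerm 2 m 1) ≤ (p : ℚ) ^ (-1 : ℤ) := by
  have : padicNorm p ((2 : ℕ) : ℚ) = 1 := padicNorm.nat_eq_one_iff 2 |>.2 fun h =>
    h2 ((Nat.prime_dvd_prime_iff_eq hp.out Nat.prime_two).1 h)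
  rw [faulhaberTerm_two_one, padicNorm.neg, padicNorm.div, this, div_one]
  have := (padicNorm.dvd_iff_norm_le (p := p) (n := 1) (z := m)).1
    (by exact_mod_cast (pow_one p).symm ▸ hpm)
  simpa using this

theorem padicNorm_choose_le_one (p k i : ℕ) [Fact p.Prime] :
    padicNorm p (k.choose i : ℚ) ≤ (p : ℚ) ^ (-(0 : ℤ)) := by
  simpa using padicNorm.of_nat (p := p) (k.choose i)

theorem padicNorm_bernoulli_le_zpow (p i : ℕ) [Fact p.Prime] :
    padicNorm p (bernoulli i) ≤ (p : ℚ) ^ (1 : ℤ) := by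
  simpa using padicNorm_bernoulli_le p i

theorem padicNorm_sum_faulhaberTerm_le_one {p k m : ℕ} [hp : Fact p.Prime] (hk : Even k)
    (hm : m ≠ 0) (hpm : p ∣ m) :
    padicNorm p (∑ i ∈ Finset.range k, faulhaberTerm k m i) ≤ (p : ℚ) ^ (-(0 : ℤ)) := by
  have he := one_le_padicValNat_of_dvd hm hpm
  refine padicNorm.sum_le' (fun i hi => ?_) (by positivity)
  have hik := Finset.mem_range.1 hi
  by_cases hd : 2 ≤ k - i
  · refine padicNorm_faulhaberTerm_le hm (padicNorm_bernoulli_le_zpow p i)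
      (padicNorm_choose_le_one p k i) ?_
    have h1 := padicValNat_lt_of_one_lt (p := p) hd
    have h2 := Nat.le_mul_of_pos_left (k - i) he
    generalize padicValNat p (k - i + 1) = v at *
    generalize padicValNat p m = e at *
    zify at h1 h2
    linarith
  -- Here `i = k - 1` is odd, so `B_i` vanishes unless `k = 2`.
  · have hi' : Odd i := by
      obtain ⟨l, rfl⟩ := hk
      exact ⟨l - 1, by omega⟩
    by_cases hi1 : i = 1
    · obtain rfl : k = 2 := by omega
      subst hi1
      simpa using padicNorm_faulhaberTerm_two_one_le_one hpm
    · rw [faulhaberTerm_eq_zero_of_odd hi' hi1]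
      simp

theorem padicNorm_sum_faulhaberTerm_le_inv {p k m : ℕ} [hp : Fact p.Prime] (hp5 : 5 ≤ p)
    (hk : Even k) (hm : m ≠ 0) (hpm : p ∣ m) :
    padicNorm p (∑ i ∈ Finset.range k, faulhaberTerm k m i) ≤ (p : ℚ) ^ (-(1 : ℤ)) := by
  have he := one_le_padicValNat_of_dvd hm hpm
  refine padicNorm.sum_le' (fun i hi => ?_) (by positivity)
  have hik := Finset.mem_range.1 hi
  by_cases hd : 2 ≤ k - i
  · refine padicNorm_faulhaberTerm_le hm (padicNorm_bernoulli_le_zpow p i)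
      (padicNorm_choose_le_one p k i) ?_
    have h1 := (padicValNat_add_two_le_of_five_le hp5 hd).1
    have h2 := Nat.le_mul_of_pos_left (k - i) he
    generalize padicValNat p (k - i + 1) = v at *
    generalize padicValNat p m = e at *
    zify at h1 h2
    linarith
  · have hi' : Odd i := by
      obtain ⟨l, rfl⟩ := hk
      exact ⟨l - 1, by omega⟩
    by_cases hi1 : i = 1
    · obtain rfl : k = 2 := by omega
      subst hi1
      exact padicNorm_faulhaberTerm_two_one_le (by omega) hpm
    · rw [faulhaberTerm_eq_zero_of_odd hi' hi1]
      simp only [padicNorm.zero]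
      positivity

/-- With `d = k - i`, only `d = 2` is delicate: a pole of `B_(k-2)` must be cancelled by `p ∣
k.choose 2`, which `h` supplies. -/
theorem padicNorm_sum_faulhaberTerm_le {p k m : ℕ} [hp : Fact p.Prime] (hp5 : 5 ≤ p)
    (hk : Even k) (hk4 : 4 ≤ k) (hm : m ≠ 0) (hpm : p ∣ m) (h : (p - 1) ∣ k - 2 → p ∣ k) :
    padicNorm p (∑ i ∈ Finset.range k, faulhaberTerm k m i) ≤
      (p : ℚ) ^ (-(2 * padicValNat p m : ℤ)) := by
  have he := one_le_padicValNat_of_dvd hm hpm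
  refine padicNorm.sum_le' (fun i hi => ?_) (by positivity)
  have hik := Finset.mem_range.1 hi
  obtain hd | hd | hd : 3 ≤ k - i ∨ k - i = 2 ∨ k - i = 1 := by omega
  · refine padicNorm_faulhaberTerm_le hm (padicNorm_bernoulli_le_zpow p i)
      (padicNorm_choose_le_one p k i) ?_
    have h1 := (padicValNat_add_two_le_of_five_le hp5 (by omega : 2 ≤ k - i)).2 hd
    generalize padicValNat p (k - i + 1) = v at *
    generalize padicValNat p m = e at *
    zify at h1 he hd
    -- Uses `1 + v ≤ d - 2 ≤ (d - 2)e`.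
    nlinarith
  · have h3 : padicValNat p (k - i + 1) = 0 := by
      rw [hd]
      exact padicValNat.eq_zero_of_not_dvd (Nat.not_dvd_of_pos_of_lt (by norm_num) (by omega))
    obtain rfl : i = k - 2 := by omega
    by_cases hdvd : (p - 1) ∣ k - 2
    · have hC : padicNorm p (k.choose (k - 2) : ℚ) ≤ (p : ℚ) ^ (-(1 : ℤ)) := by
        have hpC : p ∣ k.choose (k - 2) := by
          rw [Nat.choose_symm (by omega)]
          have h2 : k.choose 2 * 2 = k * (k - 1) := by
            rw [Nat.choose_two_right]
            exact Nat.div_mul_cancel (Nat.even_mul_pred_self k).two_dvd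
          refine (hp.out.dvd_mul.1 (h2 ▸ (h hdvd).mul_right _)).resolve_right ?_
          exact Nat.not_dvd_of_pos_of_lt (by norm_num) (by omega)
        have := (padicNorm.dvd_iff_norm_le (p := p) (n := 1) (z := (k.choose (k - 2) : ℕ))).1
          (by exact_mod_cast (pow_one p).symm ▸ hpC)
        simpa using this
      refine padicNorm_faulhaberTerm_le hm (padicNorm_bernoulli_le_zpow p _) hC ?_
      rw [h3, hd]
      push_cast
      linarith
    · have hB : padicNorm p (bernoulli (k - 2)) ≤ (p : ℚ) ^ (0 : ℤ) := by
        simpa using padicNorm_bernoulli_le_one ((Nat.even_sub (by omega)).2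
          (iff_of_true hk even_two)) hdvd
      refine padicNorm_faulhaberTerm_le hm hB (padicNorm_choose_le_one p k _) ?_
      rw [h3, hd]
      push_cast
      linarith
  · have hi' : Odd i := by
      obtain ⟨l, rfl⟩ := hk
      exact ⟨l - 1, by omega⟩
    rw [faulhaberTerm_eq_zero_of_odd hi' (by omega), padicNorm.zero]
    positivity

/-! ### Comparing the valuations of `S_k(m)/m` and `B_k` -/

theorem padicValRat_eq_or_le_of_padicNorm_sub_le {p : ℕ} [hp : Fact p.Prime] {x y : ℚ}
    (hx : x ≠ 0) (hy : y ≠ 0) {n : ℤ} (h : padicNorm p (y - x) ≤ (p : ℚ) ^ (-n)) :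
    padicValRat p x = padicValRat p y ∨ (n ≤ padicValRat p x ∧ n ≤ padicValRat p y) := by
  have hp1 : (1 : ℚ) < p := mod_cast hp.out.one_lt
  have key : ∀ z : ℚ, z ≠ 0 → (padicNorm p z ≤ (p : ℚ) ^ (-n) ↔ n ≤ padicValRat p z) := by
    intro z hz
    rw [padicNorm.eq_zpow_of_nonzero hz, zpow_le_zpow_iff_right₀ hp1, neg_le_neg_iff]
  by_cases hxn : padicNorm p x ≤ (p : ℚ) ^ (-n)
  · refine Or.inr ⟨(key x hx).1 hxn, (key y hy).1 ?_⟩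
    rw [show y = (y - x) + x by ring]
    exact padicNorm.nonarchimedean.trans (max_le h hxn)
  · left
    push Not at hxn
    have hlt := h.trans_lt hxn
    have heq : padicNorm p y = padicNorm p x := by
      rw [show y = (y - x) + x by ring, padicNorm.add_eq_max_of_ne hlt.ne, max_eq_right hlt.le]
    rw [padicNorm.eq_zpow_of_nonzero hx, padicNorm.eq_zpow_of_nonzero hy,
      zpow_right_inj₀ (by linarith) hp1.ne', neg_inj] at heq
    exact heq.symm

theorem bernoulli_even_ne_zero {k : ℕ} (hk : Even k) (hk0 : 0 < k) : bernoulli k ≠ 0 := by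
  intro h
  have : Fact (Nat.Prime 2) := ⟨Nat.prime_two⟩
  have := padicNorm_bernoulli_eq (p := 2) hk hk0 (by simp)
  rw [h, padicNorm.zero] at this
  norm_num at this

/-- If `p` divided `B_k`, the case `m = p` of the Faulhaber estimate would force `p^2 ∣ S_k(p)`,
against `prime_sq_not_dvd_sum_pow`. -/
theorem padicNorm_bernoulli_eq_one {p k : ℕ} [hp : Fact p.Prime] (hp5 : 5 ≤ p) (hk : Even k)
    (hk0 : 0 < k) (h : ¬ (p - 1) ∣ k) (hmod : (p - 1) ∣ k - 2) (hpk : ¬ p ∣ k) :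
    padicNorm p (bernoulli k) = 1 := by
  refine le_antisymm (padicNorm_bernoulli_le_one hk h) ?_
  by_contra hlt
  push Not at hlt
  have hp0 : (p : ℚ) ≠ 0 := mod_cast hp.out.ne_zero
  have hsum := padicNorm_sum_faulhaberTerm_le_inv hp5 hk hp.out.ne_zero dvd_rfl
  rw [← sum_range_pow_div_eq hp.out.ne_zero] at hsum
  have hlt1 : (p : ℚ) ^ (-(1 : ℤ)) < 1 := by
    rw [zpow_neg_one]
    exact inv_lt_one_of_one_lt₀ (mod_cast hp.out.one_lt)
  have hS : padicNorm p ((∑ j ∈ Finset.range p, (j : ℚ) ^ k) / p) < 1 := by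
    rw [← sub_add_cancel ((∑ j ∈ Finset.range p, (j : ℚ) ^ k) / p) (bernoulli k)]
    exact padicNorm.nonarchimedean.trans_lt (max_lt (hsum.trans_lt hlt1) hlt)
  obtain ⟨t, ht⟩ := hp.out.odd_of_ne_two (by omega)
  refine prime_sq_not_dvd_sum_pow hp.out ht (by omega) (by obtain ⟨l, rfl⟩ := hk; omega) hpk hmod ?_
  have hN0 : (∑ j ∈ Finset.range p, j ^ k) ≠ 0 := by
    intro h0
    have := Finset.sum_eq_zero_iff.1 h0 1 (Finset.mem_range.2 (by omega))
    simp at this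
  have hcast : (∑ j ∈ Finset.range p, (j : ℚ) ^ k) = ((∑ j ∈ Finset.range p, j ^ k : ℕ) : ℚ) := by
    push_cast; rfl
  have hp1 : (1 : ℚ) < p := mod_cast hp.out.one_lt
  rw [hcast, padicNorm.div, padicNorm.padicNorm_p_of_prime, padicNorm_natCast_eq_zpow hN0,
    div_inv_eq_mul, ← zpow_add_one₀ hp0, zpow_lt_one_iff_right₀ hp1] at hS
  rw [padicValNat_dvd_iff_le hN0]
  omega

theorem powerSum_eq_sum_range {k : ℕ} (hk : 0 < k) (m : ℕ) :
    powerSum k m = ∑ j ∈ Finset.range m, j ^ k := by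
  cases m with
  | zero => simp [powerSum]
  | succ n => rw [Finset.sum_range_eq_add_Ico _ n.succ_pos, powerSum]; simp [hk.ne']

theorem powerSum_ne_zero {k m : ℕ} (hm : 2 ≤ m) : powerSum k m ≠ 0 := by
  intro h
  have := Finset.sum_eq_zero_iff.1 h 1 (Finset.mem_Ico.2 (by omega))
  simp at this

theorem padicValNat_powerSum_gcd {p k m : ℕ} [hp : Fact p.Prime] (hk : Even k) (hk0 : 0 < k)
    (hm : m ≠ 0) (hpm : p ∣ m) :
    min (padicValNat p (powerSum k m)) (3 * padicValNat p m) +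
        min (padicValNat p (bernoulliDen k)) (padicValNat p m) =
      padicValNat p m + min (padicValNat p (bernoulliNum k).natAbs) (2 * padicValNat p m) := by
  have he := one_le_padicValNat_of_dvd hm hpm
  have hp1 : (1 : ℚ) < p := mod_cast hp.out.one_lt
  have hS := powerSum_ne_zero (k := k) (hp.out.two_le.trans (Nat.le_of_dvd (by omega) hpm))
  have hx := bernoulli_even_ne_zero hk hk0
  have hy : (powerSum k m : ℚ) / m ≠ 0 := div_ne_zero (mod_cast hS) (mod_cast hm)
  have hdiff : (powerSum k m : ℚ) / m - bernoulli k =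
      ∑ i ∈ Finset.range k, faulhaberTerm k m i := by
    rw [← sum_range_pow_div_eq hm, powerSum_eq_sum_range hk0]
    push_cast; rfl
  have hvx : padicValRat p (bernoulli k) =
      padicValNat p (bernoulliNum k).natAbs - padicValNat p (bernoulliDen k) := rfl
  have hvy : padicValRat p ((powerSum k m : ℚ) / m) =
      padicValNat p (powerSum k m) - padicValNat p m := by
    rw [padicValRat.div (mod_cast hS) (mod_cast hm), padicValRat.of_nat, padicValRat.of_nat]
  -- Lowest terms: `v_p(B_k)` alone determines both valuations.
  have hcop : padicValNat p (bernoulliNum k).natAbs = 0 ∨ padicValNat p (bernoulliDen k) = 0 := by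
    by_contra! hne
    exact Nat.not_coprime_of_dvd_of_dvd hp.out.one_lt (dvd_of_one_le_padicValNat (Nat.one_le_iff_ne_zero.2 hne.1))
      (dvd_of_one_le_padicValNat (Nat.one_le_iff_ne_zero.2 hne.2)) (bernoulli k).reduced
  have hnorm := padicNorm.eq_zpow_of_nonzero (p := p) hx
  by_cases h1 : (p - 1) ∣ k
  · have hv : padicValRat p (bernoulli k) = -1 := by
      have hB := padicNorm_bernoulli_eq hk hk0 h1
      rw [hnorm] at hB
      have := (zpow_right_inj₀ (by linarith) hp1.ne').1 (hB.trans (zpow_one (p : ℚ)).symm)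
      omega
    have := padicValRat_eq_or_le_of_padicNorm_sub_le hx hy
      (hdiff ▸ padicNorm_sum_faulhaberTerm_le_one hk hm hpm)
    omega
  · have hp5 : 5 ≤ p := by
      obtain ⟨l, rfl⟩ := even_iff_two_dvd.1 hk
      have h2 := hp.out.two_le
      by_contra hlt
      obtain rfl | rfl | rfl : p = 2 ∨ p = 3 ∨ p = 4 := by omega
      · exact h1 (one_dvd _)
      · exact h1 (dvd_mul_right 2 l)
      · exact absurd hp.out (by norm_num)
    have hv : 0 ≤ padicValRat p (bernoulli k) := by
      have hB := padicNorm_bernoulli_le_one hk h1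
      rw [hnorm, zpow_le_one_iff_right₀ hp1] at hB
      omega
    by_cases h2 : (p - 1) ∣ k - 2 ∧ ¬ p ∣ k
    · have hv0 : padicValRat p (bernoulli k) = 0 := by
        have hB := padicNorm_bernoulli_eq_one hp5 hk hk0 h1 h2.1 h2.2
        rw [hnorm] at hB
        have := (zpow_right_inj₀ (by linarith) hp1.ne').1 (hB.trans (zpow_zero (p : ℚ)).symm)
        omega
      have := padicValRat_eq_or_le_of_padicNorm_sub_le hx hy
        (hdiff ▸ padicNorm_sum_faulhaberTerm_le_inv hp5 hk hm hpm)
      omega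
    -- `k = 2` is always exceptional: `p - 1 ∣ 0` and `p ∤ 2`.
    · have hk4 : 4 ≤ k := by
        by_contra hlt
        obtain rfl : k = 2 := by obtain ⟨l, rfl⟩ := hk; omega
        exact h2 ⟨dvd_zero _, Nat.not_dvd_of_pos_of_lt (by norm_num) (by omega)⟩
      have := padicValRat_eq_or_le_of_padicNorm_sub_le hx hy
        (hdiff ▸ padicNorm_sum_faulhaberTerm_le hp5 hk hk4 hm hpm
          fun h => by_contra fun h' => h2 ⟨h, h'⟩)
      omega

theorem mainTheorem3 (k m : ℕ) (hk : 0 < k) (hm : 0 < m) (hk_even : Even k) :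
    (Nat.gcd (powerSum k m) (m ^ 3) : ℚ) / (m : ℚ) =
      (Int.gcd (bernoulliNum k) ((m : ℤ) ^ 2) : ℚ) / (Nat.gcd (bernoulliDen k) m : ℚ) := by
  -- `m = 1` is separate because `S_k(1) = 0` has no factorization.
  obtain rfl | hm2 : m = 1 ∨ 2 ≤ m := by omega
  · simp
  have hS := powerSum_ne_zero (k := k) hm2
  have hD : bernoulliDen k ≠ 0 := (bernoulli k).den_nz
  have hN : (bernoulliNum k).natAbs ≠ 0 :=
    Int.natAbs_ne_zero.2 (Rat.num_ne_zero.2 (bernoulli_even_ne_zero hk_even hk))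
  have hg1 : Nat.gcd (powerSum k m) (m ^ 3) ≠ 0 := Nat.gcd_ne_zero_left hS
  have hg2 : Nat.gcd (bernoulliDen k) m ≠ 0 := Nat.gcd_ne_zero_left hD
  have hg3 : Nat.gcd (bernoulliNum k).natAbs (m ^ 2) ≠ 0 := Nat.gcd_ne_zero_left hN
  have hgcd : Int.gcd (bernoulliNum k) ((m : ℤ) ^ 2) =
      Nat.gcd (bernoulliNum k).natAbs (m ^ 2) := by
    rw [Int.gcd, Int.natAbs_pow, Int.natAbs_natCast]
  have key : Nat.gcd (powerSum k m) (m ^ 3) * Nat.gcd (bernoulliDen k) m =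
      Nat.gcd (bernoulliNum k).natAbs (m ^ 2) * m := by
    refine Nat.eq_of_factorization_eq (mul_ne_zero hg1 hg2) (mul_ne_zero hg3 hm.ne') fun p => ?_
    by_cases hp : p.Prime
    · have : Fact p.Prime := ⟨hp⟩
      rw [Nat.factorization_mul hg1 hg2, Nat.factorization_mul hg3 hm.ne',
        Nat.factorization_gcd hS (by positivity), Nat.factorization_gcd hD hm.ne',
        Nat.factorization_gcd hN (by positivity), Nat.factorization_pow, Nat.factorization_pow]
      simp only [Finsupp.add_apply, Finsupp.inf_apply, Finsupp.smul_apply, smul_eq_mul,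
        Nat.factorization_def _ hp]
      by_cases hpm : p ∣ m
      · have := padicValNat_powerSum_gcd hk_even hk hm.ne' hpm
        omega
      · simp [padicValNat.eq_zero_of_not_dvd hpm]
    · simp [Nat.factorization_eq_zero_of_not_prime _ hp]
  rw [hgcd, div_eq_div_iff (by positivity) (by positivity)]
  exact_mod_cast key
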